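/- A represented space is a set $X$ with a partial surjection $\delta_X :\subseteq \mathbb{N}^{\mathbb{N}} \to X$ (if $\delta_X(p)=x$, then $p$ is a name of $x$). A map between represented spaces is computable if some oracle machine transforms every name of a point into a name of its image; a computable isomorphism is a bijection that is computable in both directions. The space $\mathbb{N}$ carries the representation $p \mapsto p(0)$, and Sierpinski space $\mathbb{S} = \{\top,\bot\}$ the representation in which $0^\omega$ is the only name of $\bot$ and every other sequence is a name of $\top$. A subset of $X$ is computably open if its characteristic function $X \to \mathbb{S}$ is computable. A represented space $X$ is computably discrete (computably Hausdorff) if the diagonal of $X \times X$ (the complement of the diagonal) is computably open. It is computably overt if the map $\mathcal{O}(X) \to \mathbb{S}$ that tells whether an open set is non-empty is computable, where $\mathcal{O}(X) = \mathbb{S}^X$ is the function space. It is computably Quasi-Polish if it is computably overt and computably isomorphic to the space $\mathbf{I}(\ll)$ of some computably enumerable transitive relation $\ll$ on $\mathbb{N}$; the points of $\mathbf{I}(\ll)$ are the non-empty, downwards closed, upwards directed subsets of $\mathbb{N}$ with respect to $\ll$, and $p$ is a name of $I$ iff $I = \{p(k) \mid k \in \mathbb{N}\}$. It is a computable metric space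 if it is computably isomorphic to $X_d$ for some computable pseudometric $d : \mathbb{N} \times \mathbb{N} \to \mathbb{R}$; here $X_d$ is the metric completion of $(\mathbb{N},d)$, and $p$ is a name of $x$ iff $d(p(n),x) < 2^{-n}$ for all $n$. Proposition. Let $X$ be an infinite, computably discrete, computably Quasi-Polish represented space. Then the following are equivalent: 1. $X$ is computably isomorphic to $\mathbb{N}$. 2. There is a computable injection $\iota : X \to \mathbb{N}$. 3. $X$ is a computable metric space. 4. $X$ is computably Hausdorff. -/

import Mathlib

universe u v

namespace CompTop

/-! ### Oracle machines

The machine model is Kleene's: programs for functions that are partial recursive relative to an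
oracle `p : ℕ → ℕ`. -/

/-- Programs with access to an oracle. -/
inductive OracleCode : Type
  | zero : OracleCode
  | succ : OracleCode
  | left : OracleCode
  | right : OracleCode
  | oracle : OracleCode
  | pair : OracleCode → OracleCode → OracleCode
  | comp : OracleCode → OracleCode → OracleCode
  | prec : OracleCode → OracleCode → OracleCode
  | rfind : OracleCode → OracleCode

namespace OracleCode

/-- The partial function computed by a program with oracle `p`: the smallest class containing
zero, successor, the unpairing functions and the oracle, closed under pairing, composition,
primitive recursion and unbounded search. -/
def eval (p : ℕ → ℕ) : OracleCode → ℕ →. ℕ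
  | zero => fun _ => Part.some 0
  | succ => fun n => Part.some (n + 1)
  | left => fun n => Part.some n.unpair.1
  | right => fun n => Part.some n.unpair.2
  | oracle => fun n => Part.some (p n)
  | pair cf cg => fun n => Nat.pair <$> eval p cf n <*> eval p cg n
  | comp cf cg => fun n => eval p cg n >>= eval p cf
  | prec cf cg =>
    Nat.unpaired fun a n =>
      n.rec (eval p cf a) fun y IH => do
        let i ← IH
        eval p cg (Nat.pair a (Nat.pair y i))
  | rfind cf => fun a => Nat.rfind fun n => (fun m => m = 0) <$> eval p cf (Nat.pair a n)

/-- The number of a program. -/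
def toNat : OracleCode → ℕ
  | zero => 0
  | succ => 1
  | left => 2
  | right => 3
  | oracle => 4
  | pair cf cg => 4 * Nat.pair cf.toNat cg.toNat + 5
  | comp cf cg => 4 * Nat.pair cf.toNat cg.toNat + 6
  | prec cf cg => 4 * Nat.pair cf.toNat cg.toNat + 7
  | rfind cf => 4 * cf.toNat + 8

/-- The program with a given number: an effective numbering of all programs. -/
def ofNat : ℕ → OracleCode
  | 0 => zero
  | 1 => succ
  | 2 => left
  | 3 => right
  | 4 => oracle
  | n + 5 =>
    have h : n / 4 < n + 5 := by omega
    have _h₁ : (n / 4).unpair.1 < n + 5 := lt_of_le_of_lt (Nat.unpair_left_le _) h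
    have _h₂ : (n / 4).unpair.2 < n + 5 := lt_of_le_of_lt (Nat.unpair_right_le _) h
    match n % 4 with
    | 0 => pair (ofNat (n / 4).unpair.1) (ofNat (n / 4).unpair.2)
    | 1 => comp (ofNat (n / 4).unpair.1) (ofNat (n / 4).unpair.2)
    | 2 => prec (ofNat (n / 4).unpair.1) (ofNat (n / 4).unpair.2)
    | _ => rfind (ofNat (n / 4))

theorem ofNat_toNat (c : OracleCode) : ofNat c.toNat = c := by
  induction c with
  | zero | succ | left | right | oracle => simp [toNat, ofNat]
  | pair cf cg hf hg =>
    have h₁ : (4 * Nat.pair cf.toNat cg.toNat) / 4 = Nat.pair cf.toNat cg.toNat := by omega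
    have h₂ : (4 * Nat.pair cf.toNat cg.toNat) % 4 = 0 := by omega
    rw [toNat, ofNat]
    simp [h₂, h₁, hf, hg]
  | comp cf cg hf hg =>
    have h₁ : (4 * Nat.pair cf.toNat cg.toNat + 1) / 4 = Nat.pair cf.toNat cg.toNat := by omega
    have h₂ : (4 * Nat.pair cf.toNat cg.toNat + 1) % 4 = 1 := by omega
    rw [toNat, ofNat]
    simp [h₂, h₁, hf, hg]
  | prec cf cg hf hg =>
    have h₁ : (4 * Nat.pair cf.toNat cg.toNat + 2) / 4 = Nat.pair cf.toNat cg.toNat := by omega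
    have h₂ : (4 * Nat.pair cf.toNat cg.toNat + 2) % 4 = 2 := by omega
    rw [toNat, ofNat]
    simp [h₂, h₁, hf, hg]
  | rfind cf hf =>
    have h₁ : (4 * cf.toNat + 3) / 4 = cf.toNat := by omega
    have h₂ : (4 * cf.toNat + 3) % 4 = 3 := by omega
    rw [toNat, ofNat]
    simp [h₂, h₁, hf]

/-- `c.Maps p q`: the partial map on Baire space computed by `c` is defined at `p` with
value `q`. -/
def Maps (c : OracleCode) (p q : ℕ → ℕ) : Prop :=
  ∀ n, q n ∈ c.eval p n

end OracleCode

/-- Interleaving of two sequences: `p` on even positions, `q` on odd positions. -/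
def join (p q : ℕ → ℕ) : ℕ → ℕ :=
  fun n => if n % 2 = 0 then p (n / 2) else q (n / 2)

theorem join_even (p q : ℕ → ℕ) : (fun n => join p q (2 * n)) = p := by
  funext n
  simp [join]

theorem join_odd (p q : ℕ → ℕ) : (fun n => join p q (2 * n + 1)) = q := by
  funext n
  have h₁ : (2 * n + 1) % 2 = 1 := by omega
  have h₂ : (2 * n + 1) / 2 = n := by omega
  simp [join, h₁, h₂]

/-! ### Represented spaces -/

/-- A represented space: a set with a partial surjection from Baire space, given by its graph
`IsName p x` (that is, `p` is a name of `x`). -/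
structure RepresentedSpace where
  carrier : Type u
  IsName : (ℕ → ℕ) → carrier → Prop
  unique : ∀ {p x y}, IsName p x → IsName p y → x = y
  surj : ∀ x, ∃ p, IsName p x

instance : CoeSort RepresentedSpace.{u} (Type u) := ⟨RepresentedSpace.carrier⟩

/-- The map `f : X → Y` is computable: it has a computable realiser. -/
def ComputableMap (X : RepresentedSpace.{u}) (Y : RepresentedSpace.{v}) (f : X → Y) : Prop :=
  ∃ c : OracleCode, ∀ p x, X.IsName p x → ∃ q, c.Maps p q ∧ Y.IsName q (f x)

/-- Computable isomorphism of represented spaces. -/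
def ComputablyIsomorphic (X : RepresentedSpace.{u}) (Y : RepresentedSpace.{v}) : Prop :=
  ∃ e : X ≃ Y, ComputableMap X Y e ∧ ComputableMap Y X e.symm

/-- The represented space of natural numbers: `p` is a name of `p 0`. -/
def natSpace : RepresentedSpace.{0} where
  carrier := ℕ
  IsName p n := p 0 = n
  unique h₁ h₂ := h₁.symm.trans h₂
  surj n := ⟨fun _ => n, rfl⟩

/-- Sierpinski space: truth values, the zero sequence being the only name of `False` and every
other sequence being a name of `True`. -/
def sierpinski : RepresentedSpace.{0} where
  carrier := Prop
  IsName p t := t ↔ p ≠ fun _ => 0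
  unique h₁ h₂ := propext (h₁.trans h₂.symm)
  surj t := by
    by_cases h : t
    · exact ⟨fun _ => 1, by simp [h, funext_iff]⟩
    · exact ⟨fun _ => 0, by simp [h]⟩

/-- The product of two represented spaces. -/
def prod (X : RepresentedSpace.{u}) (Y : RepresentedSpace.{v}) : RepresentedSpace.{max u v} where
  carrier := X × Y
  IsName p z := X.IsName (fun n => p (2 * n)) z.1 ∧ Y.IsName (fun n => p (2 * n + 1)) z.2
  unique h₁ h₂ := Prod.ext (X.unique h₁.1 h₂.1) (Y.unique h₁.2 h₂.2)
  surj z := by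
    obtain ⟨p, hp⟩ := X.surj z.1
    obtain ⟨q, hq⟩ := Y.surj z.2
    exact ⟨join p q, by rw [join_even]; exact hp, by rw [join_odd]; exact hq⟩

/-- `p` codes a realiser of `f : X → Y`: `p 0` is the number of a program and the rest of `p` is an
oracle which the program has access to, next to its input. -/
def CodesRealiser (X : RepresentedSpace.{u}) (Y : RepresentedSpace.{v}) (p : ℕ → ℕ)
    (f : X → Y) : Prop :=
  ∀ q x, X.IsName q x →
    ∃ r, (OracleCode.ofNat (p 0)).Maps (join q (fun n => p (n + 1))) r ∧ Y.IsName r (f x)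

/-- The function space: its points are the continuously realisable maps from `X` to `Y`, where
a continuous partial map on Baire space is one that is computed by a program relative to some
additional oracle. The names of a map are the codes of its realisers. -/
def functionSpace (X : RepresentedSpace.{u}) (Y : RepresentedSpace.{v}) :
    RepresentedSpace.{max u v} where
  carrier := {f : X → Y // ∃ p, CodesRealiser X Y p f}
  IsName p f := CodesRealiser X Y p f.1
  unique := by
    intro p f g hf hg
    apply Subtype.ext
    funext x
    obtain ⟨q, hq⟩ := X.surj x
    obtain ⟨r, hr, hrf⟩ := hf q x hq
    obtain ⟨s, hs, hsg⟩ := hg q x hq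
    have hrs : r = s := funext fun n => Part.mem_unique (hr n) (hs n)
    subst hrs
    exact Y.unique hrf hsg
  surj f := f.2

/-- The space of open subsets of `X`, identified with their characteristic functions into
Sierpinski space. -/
def opens (X : RepresentedSpace.{u}) : RepresentedSpace.{u} :=
  functionSpace X sierpinski

/-- `X` is computably overt: non-emptiness of a given open subset of `X` is semidecidable. -/
def ComputablyOvert (X : RepresentedSpace.{u}) : Prop :=
  ComputableMap (opens X) sierpinski fun U => ∃ x : X, U.1 x

/-- A subset of `X` is computably open if its characteristic function into Sierpinski space is
computable. -/
def ComputablyOpen (X : RepresentedSpace.{u}) (U : Set X) : Prop :=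
  ComputableMap X sierpinski fun x => x ∈ U

/-- A subset of `X` is computably closed if its complement is computably open. -/
def ComputablyClosed (X : RepresentedSpace.{u}) (A : Set X) : Prop :=
  ComputablyOpen X Aᶜ

/-- The diagonal of `X`, a subset of `X × X`. -/
def diagonal (X : RepresentedSpace.{u}) : Set (prod X X) :=
  Set.diagonal X.carrier

/-- `X` is computably discrete: the diagonal is computably open. -/
def ComputablyDiscrete (X : RepresentedSpace.{u}) : Prop :=
  ComputablyOpen (prod X X) (diagonal X)

/-- `X` is computably Hausdorff: the diagonal is computably closed. -/
def ComputablyHausdorff (X : RepresentedSpace.{u}) : Prop :=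
  ComputablyClosed (prod X X) (diagonal X)

/-! ### Computably Quasi-Polish spaces -/

/-- Ideals of a relation on the natural numbers: non-empty, downwards closed, upwards directed
sets. -/
structure IsIdeal (r : ℕ → ℕ → Prop) (I : Set ℕ) : Prop where
  nonempty : I.Nonempty
  down : ∀ x, (∃ y ∈ I, r x y) → x ∈ I
  directed : ∀ x ∈ I, ∀ y ∈ I, ∃ z ∈ I, r x z ∧ r y z

/-- The represented space of ideals of a relation: a sequence is a name of the ideal which it
enumerates. -/
def idealSpace (r : ℕ → ℕ → Prop) : RepresentedSpace.{0} where
  carrier := {I : Set ℕ // IsIdeal r I}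
  IsName p I := I.1 = Set.range p
  unique h₁ h₂ := Subtype.ext (h₁.trans h₂.symm)
  surj I := (Set.to_countable I.1).exists_eq_range I.2.nonempty

/-- `X` is precomputably Quasi-Polish: computably isomorphic to the space of ideals of some
computably enumerable transitive relation on the natural numbers. -/
def PrecomputablyQuasiPolish (X : RepresentedSpace.{u}) : Prop :=
  ∃ r : ℕ → ℕ → Prop, (∀ a b c, r a b → r b c → r a c) ∧
    REPred (fun z : ℕ × ℕ => r z.1 z.2) ∧ ComputablyIsomorphic X (idealSpace r)

/-- `X` is computably Quasi-Polish: precomputably Quasi-Polish and computably overt. -/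
def ComputablyQuasiPolish (X : RepresentedSpace.{u}) : Prop :=
  PrecomputablyQuasiPolish X ∧ ComputablyOvert X

/-! ### Computable metric spaces -/

/-- A standard numbering of the rational numbers. -/
def ratOfNat (n : ℕ) : ℚ :=
  ((n.unpair.1.unpair.1 : ℚ) - n.unpair.1.unpair.2) / (n.unpair.2 + 1)

theorem ratOfNat_surjective : Function.Surjective ratOfNat := by
  intro q
  refine ⟨Nat.pair (Nat.pair q.num.toNat (-q.num).toNat) (q.den - 1), ?_⟩
  have hd : 1 ≤ q.den := q.pos
  have hn : ((q.num.toNat : ℕ) : ℚ) - ((-q.num).toNat : ℕ) = q.num := by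
    exact_mod_cast Int.toNat_sub_toNat_neg q.num
  simp only [ratOfNat, Nat.unpair_pair, hn]
  rw [Nat.cast_sub hd]
  simpa using Rat.num_div_den q

theorem eq_of_dist_lt_two_pow {α : Type u} [MetricSpace α] {x y : α} (s : ℕ → α)
    (hx : ∀ n, dist (s n) x < (1 / 2) ^ n) (hy : ∀ n, dist (s n) y < (1 / 2) ^ n) : x = y := by
  refine dist_le_zero.1 (le_of_forall_pos_le_add fun ε hε => ?_)
  obtain ⟨n, hn⟩ := exists_pow_lt_of_lt_one (half_pos hε) (by norm_num : (1 / 2 : ℝ) < 1)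
  have := dist_triangle_left x y (s n)
  linarith [hx n, hy n]

/-- The represented space of real numbers: a name of `x` is a sequence of (numbers of) rationals,
the `n`-th of which has distance less than `2⁻ⁿ` from `x`. -/
def realSpace : RepresentedSpace.{0} where
  carrier := ℝ
  IsName p x := ∀ n, dist (ratOfNat (p n) : ℝ) x < (1 / 2) ^ n
  unique h₁ h₂ := eq_of_dist_lt_two_pow _ h₁ h₂
  surj x := by
    have h : ∀ n : ℕ, ∃ k : ℕ, dist (ratOfNat k : ℝ) x < (1 / 2) ^ n := by
      intro n
      obtain ⟨q, hq⟩ := Rat.denseRange_cast.exists_dist_lt x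
        (by positivity : (0 : ℝ) < (1 / 2) ^ n)
      obtain ⟨k, rfl⟩ := ratOfNat_surjective q
      exact ⟨k, by rwa [dist_comm]⟩
    choose p hp using h
    exact ⟨p, hp⟩

/-- A computable pseudometric on the natural numbers. -/
structure ComputablePseudometric where
  d : ℕ → ℕ → ℝ
  d_self : ∀ a, d a a = 0
  d_comm : ∀ a b, d a b = d b a
  d_triangle : ∀ a b c, d a c ≤ d a b + d b c
  computable : ComputableMap (prod natSpace natSpace) realSpace fun z : ℕ × ℕ => d z.1 z.2

/-- The natural numbers, with a given pseudometric. -/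
def ComputablePseudometric.Point (_ : ComputablePseudometric) : Type := ℕ

instance (P : ComputablePseudometric) : PseudoMetricSpace P.Point where
  dist a b := P.d a b
  dist_self := P.d_self
  dist_comm := P.d_comm
  dist_triangle := P.d_triangle

/-- The `n`-th special point in the metric completion of the natural numbers. -/
noncomputable def ComputablePseudometric.point (P : ComputablePseudometric) (n : ℕ) :
    UniformSpace.Completion P.Point :=
  ((show P.Point from n : P.Point) : UniformSpace.Completion P.Point)

/-- The represented space induced by a computable pseudometric: the metric completion of the
natural numbers, where a name of `x` is a sequence of natural numbers the `n`-th of which has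
distance less than `2⁻ⁿ` from `x`. -/
noncomputable def ComputablePseudometric.space (P : ComputablePseudometric) :
    RepresentedSpace.{0} where
  carrier := UniformSpace.Completion P.Point
  IsName p x := ∀ n, dist (P.point (p n)) x < (1 / 2) ^ n
  unique h₁ h₂ := eq_of_dist_lt_two_pow _ h₁ h₂
  surj x := by
    have h : ∀ n : ℕ, ∃ k : ℕ, dist (P.point k) x < (1 / 2) ^ n := by
      intro n
      obtain ⟨k, hk⟩ := (UniformSpace.Completion.denseRange_coe (α := P.Point)).exists_dist_lt x
        (by positivity : (0 : ℝ) < (1 / 2) ^ n)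
      exact ⟨k, by rw [dist_comm]; exact hk⟩
    choose p hp using h
    exact ⟨p, hp⟩

/-- `X` is a computable metric space: computably isomorphic to the space induced by some computable
pseudometric on the natural numbers. -/
def IsComputableMetricSpace (X : RepresentedSpace.{u}) : Prop :=
  ∃ P : ComputablePseudometric, ComputablyIsomorphic X P.space

end CompTop

-- The implications into 4 pull inequality back along an injection: it is decidable on `ℕ`, and in a
-- computable metric space `d x y > 0` is recognised from approximations. The discrete metric gives
-- 1 → 3. The substance is 4 → 1.
--
-- Work in the space of ideals. By discreteness, the semidecision of `I = I` accepts after reading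
-- finitely many entries of a name of `I`. Directedness gives `z ∈ I` above all of them. Any ideal
-- containing `z` contains those entries, so it has a name with the same beginning and must equal
-- `I`: each point is isolated by a single number (`exists_isolating`). By overtness, the numbers
-- lying in some ideal are computably enumerable (`ComputablyOvert.exists_witness`). From each of
-- them a search builds a computable ascending chain, which generates an ideal containing that
-- number; starting from an isolating number, it generates the isolated ideal. Hence the points form
-- a computable sequence, possibly with repetitions (`exists_computable_enumeration`).
--
-- Discreteness and Hausdorffness together make equality along this sequence decidable, so the
-- repetitions can be removed. The index of a given point is found by searching for a recognised
-- equality (`computablyIsomorphic_natSpace`).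

universe w

namespace CompTop

/-! ### Evaluation of oracle programs -/

namespace OracleCode

theorem mem_eval_pair {p : ℕ → ℕ} {cf cg : OracleCode} {n v : ℕ} :
    v ∈ (pair cf cg).eval p n ↔
      ∃ a ∈ cf.eval p n, ∃ b ∈ cg.eval p n, Nat.pair a b = v := by
  simp [eval, Seq.seq]

theorem mem_eval_comp {p : ℕ → ℕ} {cf cg : OracleCode} {n v : ℕ} :
    v ∈ (comp cf cg).eval p n ↔ ∃ a ∈ cg.eval p n, v ∈ cf.eval p a := by
  simp only [eval]
  exact Part.mem_bind_iff

theorem mem_eval_rfind {p : ℕ → ℕ} {cf : OracleCode} {a v : ℕ} :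
    v ∈ (rfind cf).eval p a ↔
      0 ∈ cf.eval p (Nat.pair a v) ∧ ∀ m < v, ∃ w ∈ cf.eval p (Nat.pair a m), w ≠ 0 := by
  simp only [eval]
  refine Nat.mem_rfind.trans ?_
  simp

theorem mem_eval_prec_zero {p : ℕ → ℕ} {cf cg : OracleCode} {a v : ℕ} :
    v ∈ (prec cf cg).eval p (Nat.pair a 0) ↔ v ∈ cf.eval p a := by
  simp [eval, Nat.unpaired]

theorem mem_eval_prec_succ {p : ℕ → ℕ} {cf cg : OracleCode} {a y v : ℕ} :
    v ∈ (prec cf cg).eval p (Nat.pair a (y + 1)) ↔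
      ∃ i ∈ (prec cf cg).eval p (Nat.pair a y),
        v ∈ cg.eval p (Nat.pair a (Nat.pair y i)) := by
  simp [eval, Nat.unpaired]

theorem mem_eval_zero {p : ℕ → ℕ} {n v : ℕ} : v ∈ zero.eval p n ↔ v = 0 := by
  simp [eval]

theorem mem_eval_succ {p : ℕ → ℕ} {n v : ℕ} : v ∈ succ.eval p n ↔ v = n + 1 := by
  simp [eval]

theorem mem_eval_left {p : ℕ → ℕ} {n v : ℕ} : v ∈ left.eval p n ↔ v = n.unpair.1 := by
  simp [eval]

theorem mem_eval_right {p : ℕ → ℕ} {n v : ℕ} : v ∈ right.eval p n ↔ v = n.unpair.2 := by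
  simp [eval]

theorem mem_eval_oracle {p : ℕ → ℕ} {n v : ℕ} : v ∈ oracle.eval p n ↔ v = p n := by
  simp [eval]

/-- Evaluation on `Nat.pair (Nat.pair a b) c` of the program that evaluates a given one on
`Nat.pair a (Nat.pair b c)`. -/
theorem mem_eval_assoc {p : ℕ → ℕ} {cf : OracleCode} {a b c v : ℕ}
    (h : v ∈ cf.eval p (Nat.pair a (Nat.pair b c))) :
    v ∈ (comp cf (pair (comp left left) (pair (comp right left) right))).eval p
      (Nat.pair (Nat.pair a b) c) := by
  simp only [mem_eval_comp, mem_eval_pair, mem_eval_left, mem_eval_right]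
  simpa using h

/-- A program whose oracle is computed by another program, uniformly in a parameter. -/
theorem exists_subst (d c : OracleCode) :
    ∃ c' : OracleCode, ∀ p O n, (∀ j, O j ∈ d.eval p (Nat.pair n j)) →
      ∀ k, ∀ v ∈ c.eval O k, v ∈ c'.eval p (Nat.pair n k) := by
  induction c with
  | zero => exact ⟨zero, fun p O n _ k v hv => by simpa [mem_eval_zero] using hv⟩
  | succ =>
    exact ⟨comp succ right, fun p O n _ k v hv => by
      simpa [mem_eval_comp, mem_eval_succ, mem_eval_right] using hv⟩
  | left =>
    exact ⟨comp left right, fun p O n _ k v hv => by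
      simpa [mem_eval_comp, mem_eval_left, mem_eval_right] using hv⟩
  | right =>
    exact ⟨comp right right, fun p O n _ k v hv => by
      simpa [mem_eval_comp, mem_eval_right] using hv⟩
  | oracle =>
    refine ⟨d, fun p O n h k v hv => ?_⟩
    rw [mem_eval_oracle.1 hv]
    exact h k
  | pair cf cg hf hg =>
    obtain ⟨cf', hf⟩ := hf
    obtain ⟨cg', hg⟩ := hg
    refine ⟨pair cf' cg', fun p O n h k v hv => ?_⟩
    obtain ⟨a, ha, b, hb, rfl⟩ := mem_eval_pair.1 hv
    exact mem_eval_pair.2 ⟨a, hf p O n h k a ha, b, hg p O n h k b hb, rfl⟩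
  | comp cf cg hf hg =>
    obtain ⟨cf', hf⟩ := hf
    obtain ⟨cg', hg⟩ := hg
    refine ⟨comp cf' (pair left cg'), fun p O n h k v hv => ?_⟩
    obtain ⟨a, ha, hv⟩ := mem_eval_comp.1 hv
    exact mem_eval_comp.2 ⟨Nat.pair n a, mem_eval_pair.2
      ⟨n, by simp [mem_eval_left], a, hg p O n h k a ha, rfl⟩, hf p O n h a v hv⟩
  | prec cf cg hf hg =>
    obtain ⟨cf', hf⟩ := hf
    obtain ⟨cg', hg⟩ := hg
    -- The parameter `n` becomes part of the recursion parameter: `(n, (a, y))` is regrouped as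
    -- `((n, a), y)`, and `cg'` undoes this regrouping.
    refine ⟨comp (prec cf' (comp cg' (pair (comp left left) (pair (comp right left) right))))
      (pair (pair left (comp left right)) (comp right right)), fun p O n h k => ?_⟩
    obtain ⟨⟨a, y⟩, rfl⟩ : ∃ x : ℕ × ℕ, Nat.pair x.1 x.2 = k := ⟨k.unpair, by simp⟩
    intro v hv
    refine mem_eval_comp.2 ⟨Nat.pair (Nat.pair n a) y, ?_, ?_⟩
    · simp [mem_eval_comp, mem_eval_pair, mem_eval_left, mem_eval_right]
    · induction y generalizing v with
      | zero => exact mem_eval_prec_zero.2 (hf p O n h a v (mem_eval_prec_zero.1 hv))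
      | succ y ih =>
        obtain ⟨i, hi, hv⟩ := mem_eval_prec_succ.1 hv
        exact mem_eval_prec_succ.2 ⟨i, ih i hi, mem_eval_assoc (hg p O n h _ v hv)⟩
  | rfind cf hf =>
    obtain ⟨cf', hf⟩ := hf
    refine ⟨rfind (comp cf' (pair (comp left left) (pair (comp right left) right))),
      fun p O n h k v hv => ?_⟩
    obtain ⟨h0, h1⟩ := mem_eval_rfind.1 hv
    refine mem_eval_rfind.2 ⟨mem_eval_assoc (hf p O n h _ _ h0), fun m hm => ?_⟩
    obtain ⟨w, hw, hw0⟩ := h1 m hm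
    exact ⟨w, mem_eval_assoc (hf p O n h _ _ hw), hw0⟩

/-- The generators of `Nat.Partrec` are matched by the constructors other than `oracle`, so the
program never queries. -/
theorem exists_eval_eq {f : ℕ →. ℕ} (hf : Nat.Partrec f) :
    ∃ c : OracleCode, ∀ p, c.eval p = f := by
  induction hf with
  | zero => exact ⟨zero, fun p => rfl⟩
  | succ => exact ⟨succ, fun p => rfl⟩
  | left => exact ⟨left, fun p => rfl⟩
  | right => exact ⟨right, fun p => rfl⟩
  | pair _ _ hf hg =>
    obtain ⟨cf, hf⟩ := hf
    obtain ⟨cg, hg⟩ := hg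
    exact ⟨pair cf cg, fun p => by simp only [eval, hf, hg]; rfl⟩
  | comp _ _ hf hg =>
    obtain ⟨cf, hf⟩ := hf
    obtain ⟨cg, hg⟩ := hg
    exact ⟨comp cf cg, fun p => by simp only [eval, hf, hg]; rfl⟩
  | prec _ _ hf hg =>
    obtain ⟨cf, hf⟩ := hf
    obtain ⟨cg, hg⟩ := hg
    exact ⟨prec cf cg, fun p => by simp only [eval, hf, hg]; rfl⟩
  | rfind _ hf =>
    obtain ⟨cf, hf⟩ := hf
    exact ⟨rfind cf, fun p => by simp only [eval, hf]; rfl⟩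

theorem partrec_eval {p : ℕ → ℕ} (hp : Computable p) (c : OracleCode) :
    Nat.Partrec (c.eval p) := by
  induction c with
  | zero => exact Nat.Partrec.zero
  | succ => exact Nat.Partrec.succ
  | left => exact Nat.Partrec.left
  | right => exact Nat.Partrec.right
  | oracle => exact Partrec.nat_iff.1 hp
  | pair _ _ hf hg => exact hf.pair hg
  | comp _ _ hf hg => exact hf.comp hg
  | prec _ _ hf hg => exact hf.prec hg
  | rfind _ hf => exact hf.rfind

/-- A terminating computation queries its oracle only finitely often. -/
theorem exists_use (c : OracleCode) (p : ℕ → ℕ) (n v : ℕ) (hv : v ∈ c.eval p n) :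
    ∃ N, ∀ p' : ℕ → ℕ, (∀ i < N, p' i = p i) → v ∈ c.eval p' n := by
  induction c generalizing n v with
  | zero => exact ⟨0, fun _ _ => hv⟩
  | succ => exact ⟨0, fun _ _ => hv⟩
  | left => exact ⟨0, fun _ _ => hv⟩
  | right => exact ⟨0, fun _ _ => hv⟩
  | oracle =>
    refine ⟨n + 1, fun p' h => ?_⟩
    rw [mem_eval_oracle] at hv ⊢
    rw [hv, h n n.lt_succ_self]
  | pair cf cg hf hg =>
    obtain ⟨a, ha, b, hb, rfl⟩ := mem_eval_pair.1 hv
    obtain ⟨N, hN⟩ := hf n a ha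
    obtain ⟨M, hM⟩ := hg n b hb
    exact ⟨max N M, fun p' h => mem_eval_pair.2
      ⟨a, hN p' fun i hi => h i (lt_max_of_lt_left hi),
        b, hM p' fun i hi => h i (lt_max_of_lt_right hi), rfl⟩⟩
  | comp cf cg hf hg =>
    obtain ⟨a, ha, hb⟩ := mem_eval_comp.1 hv
    obtain ⟨N, hN⟩ := hg n a ha
    obtain ⟨M, hM⟩ := hf a v hb
    exact ⟨max N M, fun p' h => mem_eval_comp.2
      ⟨a, hN p' fun i hi => h i (lt_max_of_lt_left hi),
        hM p' fun i hi => h i (lt_max_of_lt_right hi)⟩⟩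
  | prec cf cg hf hg =>
    obtain ⟨⟨a, y⟩, rfl⟩ : ∃ x : ℕ × ℕ, Nat.pair x.1 x.2 = n := ⟨n.unpair, by simp⟩
    induction y generalizing v with
    | zero =>
      obtain ⟨N, hN⟩ := hf a v (mem_eval_prec_zero.1 hv)
      exact ⟨N, fun p' h => mem_eval_prec_zero.2 (hN p' h)⟩
    | succ y ih =>
      obtain ⟨b, hb, hv⟩ := mem_eval_prec_succ.1 hv
      obtain ⟨N, hN⟩ := ih b hb
      obtain ⟨M, hM⟩ := hg _ v hv
      exact ⟨max N M, fun p' h => mem_eval_prec_succ.2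
        ⟨b, hN p' fun i hi => h i (lt_max_of_lt_left hi),
          hM p' fun i hi => h i (lt_max_of_lt_right hi)⟩⟩
  | rfind cf hf =>
    obtain ⟨h0, h1⟩ := mem_eval_rfind.1 hv
    obtain ⟨N, hN⟩ := hf _ _ h0
    choose! w hw hw0 using h1
    choose! M hM using fun m hm => hf _ _ (hw m hm)
    refine ⟨max N ((Finset.range v).sup M), fun p' h => mem_eval_rfind.2
      ⟨hN p' fun i hi => h i (lt_max_of_lt_left hi), fun m hm => ⟨w m, ?_, hw0 m hm⟩⟩⟩
    exact hM m hm p' fun i hi => h i (lt_max_of_lt_right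
      (hi.trans_le (Finset.le_sup (f := M) (Finset.mem_range.2 hm))))

end OracleCode

/-! ### Calculus of computable functionals -/

/-- The functional `F` is computed on the oracles in `D` by a single oracle program. -/
def OracleComputableOn (D : Set (ℕ → ℕ)) (F : (ℕ → ℕ) → ℕ → ℕ) : Prop :=
  ∃ c : OracleCode, ∀ p ∈ D, ∀ n, F p n ∈ c.eval p n

namespace OracleComputableOn

variable {D : Set (ℕ → ℕ)} {F G : (ℕ → ℕ) → ℕ → ℕ}

theorem congr (hF : OracleComputableOn D F) (h : ∀ p ∈ D, ∀ n, F p n = G p n) :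
    OracleComputableOn D G := by
  obtain ⟨c, hc⟩ := hF
  exact ⟨c, fun p hp n => h p hp n ▸ hc p hp n⟩

theorem oracle : OracleComputableOn D fun p n => p n :=
  ⟨.oracle, fun _ _ _ => OracleCode.mem_eval_oracle.2 rfl⟩

theorem of_computable {f : ℕ → ℕ} (hf : Computable f) : OracleComputableOn D fun _ n => f n := by
  obtain ⟨c, hc⟩ := OracleCode.exists_eval_eq (Partrec.nat_iff.1 hf)
  exact ⟨c, fun p _ n => by rw [hc]; simp⟩

theorem comp (hF : OracleComputableOn D F) (hG : OracleComputableOn D G) :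
    OracleComputableOn D fun p n => F p (G p n) := by
  obtain ⟨c, hc⟩ := hF
  obtain ⟨d, hd⟩ := hG
  exact ⟨.comp c d, fun p hp n => OracleCode.mem_eval_comp.2 ⟨_, hd p hp n, hc p hp _⟩⟩

theorem pair (hF : OracleComputableOn D F) (hG : OracleComputableOn D G) :
    OracleComputableOn D fun p n => Nat.pair (F p n) (G p n) := by
  obtain ⟨c, hc⟩ := hF
  obtain ⟨d, hd⟩ := hG
  exact ⟨.pair c d, fun p hp n =>
    OracleCode.mem_eval_pair.2 ⟨_, hc p hp n, _, hd p hp n, rfl⟩⟩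

theorem map {f : ℕ → ℕ} (hf : Computable f) (hF : OracleComputableOn D F) :
    OracleComputableOn D fun p n => f (F p n) :=
  (of_computable hf).comp hF

theorem map₂ {f : ℕ → ℕ → ℕ} (hf : Computable₂ f) (hF : OracleComputableOn D F)
    (hG : OracleComputableOn D G) : OracleComputableOn D fun p n => f (F p n) (G p n) :=
  ((of_computable (f := fun n => f n.unpair.1 n.unpair.2)
    (hf.comp (Computable.fst.comp Computable.unpair)
      (Computable.snd.comp Computable.unpair))).comp (hF.pair hG)).congr (by simp)

theorem query (hF : OracleComputableOn D F) : OracleComputableOn D fun p n => p (F p n) :=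
  oracle.comp hF

theorem precomp {f : ℕ → ℕ} (hF : OracleComputableOn D F) (hf : Computable f) :
    OracleComputableOn D fun p n => F p (f n) :=
  hF.comp (of_computable hf)

theorem find (hG : OracleComputableOn D G)
    (h : ∀ p ∈ D, ∀ n, ∃ k, G p (Nat.pair n k) = 0) :
    ∃ F, OracleComputableOn D F ∧ ∀ p ∈ D, ∀ n, G p (Nat.pair n (F p n)) = 0 := by
  obtain ⟨c, hc⟩ := hG
  refine ⟨fun p n => sInf {k | G p (Nat.pair n k) = 0}, ⟨.rfind c, fun p hp n => ?_⟩,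
    fun p hp n => Nat.sInf_mem (s := {k | G p (Nat.pair n k) = 0}) (h p hp n)⟩
  refine OracleCode.mem_eval_rfind.2 ⟨?_, fun m hm => ⟨_, hc p hp _, 
    Nat.notMem_of_lt_sInf (s := {k | G p (Nat.pair n k) = 0}) hm⟩⟩
  have := Nat.sInf_mem (s := {k | G p (Nat.pair n k) = 0}) (h p hp n)
  have h' := hc p hp (Nat.pair n (sInf {k | G p (Nat.pair n k) = 0}))
  rwa [show G p _ = 0 from this] at h'

/-- Substitution of a computable family of functions, given by `G`, for the oracle. -/
theorem subst {D' : Set (ℕ → ℕ)} (hF : OracleComputableOn D' F) (hG : OracleComputableOn D G)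
    (h : ∀ p ∈ D, ∀ n, (fun k => G p (Nat.pair n k)) ∈ D') :
    OracleComputableOn D fun p n => F (fun k => G p (Nat.pair n.unpair.1 k)) n.unpair.2 := by
  obtain ⟨c, hc⟩ := hF
  obtain ⟨d, hd⟩ := hG
  obtain ⟨c', hc'⟩ := OracleCode.exists_subst d c
  refine ⟨c', fun p hp n => ?_⟩
  have := hc' p (fun k => G p (Nat.pair n.unpair.1 k)) n.unpair.1 (fun j => hd p hp _) n.unpair.2
    _ (hc _ (h p hp _) _)
  rwa [Nat.pair_unpair] at this

/-- A single function is a family constant in its parameter, which is then fixed to `0`. -/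
theorem subst' {D' : Set (ℕ → ℕ)} (hF : OracleComputableOn D' F) (hG : OracleComputableOn D G)
    (h : ∀ p ∈ D, G p ∈ D') : OracleComputableOn D fun p n => F (G p) n := by
  have h₁ : OracleComputableOn D fun p n => G p n.unpair.2 :=
    hG.precomp (Computable.snd.comp Computable.unpair)
  have h₂ := hF.subst h₁ (fun p hp n => by simpa using h p hp)
  exact (h₂.precomp (f := fun n => Nat.pair 0 n)
    (Primrec₂.natPair.to_comp.comp (Computable.const 0) Computable.id)).congr (by simp)

theorem computable {p : ℕ → ℕ} (hF : OracleComputableOn D F) (hp : p ∈ D) (hpc : Computable p) :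
    Computable (F p) := by
  obtain ⟨c, hc⟩ := hF
  exact (Partrec.nat_iff.2 (OracleCode.partrec_eval hpc c)).of_eq
    fun n => Part.eq_some_iff.2 (hc p hp n)

/-- Feeding a computable sequence of names to a realiser leaves no genuine oracle: after `subst` the
remaining one can be the zero sequence. -/
theorem computable₂ {P : ℕ → ℕ → ℕ} (hF : OracleComputableOn D F) (hP : Computable₂ P)
    (h : ∀ n, P n ∈ D) : Computable₂ fun n k => F (P n) k := by
  have h₁ : OracleComputableOn Set.univ fun _ n => P n.unpair.1 n.unpair.2 :=
    of_computable (hP.comp (Computable.fst.comp Computable.unpair)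
      (Computable.snd.comp Computable.unpair))
  have h₂ := (hF.subst h₁ (by simpa using h)).computable (p := fun _ => 0) trivial
    (Computable.const 0)
  exact (h₂.comp Primrec₂.natPair.to_comp).of_eq (by simp)

theorem exists_use (hF : OracleComputableOn D F) {p : ℕ → ℕ} (hp : p ∈ D) (n : ℕ) :
    ∃ N, ∀ p' ∈ D, (∀ i < N, p' i = p i) → F p' n = F p n := by
  obtain ⟨c, hc⟩ := hF
  obtain ⟨N, hN⟩ := c.exists_use p n _ (hc p hp n)
  exact ⟨N, fun p' hp' h => Part.mem_unique (hc p' hp' n) (hN p' h)⟩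

end OracleComputableOn

theorem computable₂_ite_eq (a b : ℕ) : Computable₂ fun m n : ℕ => if m = n then a else b :=
  (Primrec.ite (Primrec.eq.comp Primrec.fst Primrec.snd) (Primrec.const a)
    (Primrec.const b)).to_comp

theorem computable_two_mul : Computable fun n : ℕ => 2 * n :=
  (Primrec.nat_mul.comp (Primrec.const 2) Primrec.id).to_comp

theorem computable_two_mul_add_one : Computable fun n : ℕ => 2 * n + 1 :=
  Computable.succ.comp computable_two_mul

theorem OracleComputableOn.even {D : Set (ℕ → ℕ)} :
    OracleComputableOn D fun p n => p (2 * n) :=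
  oracle.precomp computable_two_mul

theorem OracleComputableOn.odd {D : Set (ℕ → ℕ)} :
    OracleComputableOn D fun p n => p (2 * n + 1) :=
  oracle.precomp computable_two_mul_add_one

theorem OracleComputableOn.join {D : Set (ℕ → ℕ)} {F G : (ℕ → ℕ) → ℕ → ℕ}
    (hF : OracleComputableOn D F) (hG : OracleComputableOn D G) :
    OracleComputableOn D fun p => CompTop.join (F p) (G p) := by
  have half : Computable fun n : ℕ => n / 2 :=
    (Primrec.nat_div.comp Primrec.id (Primrec.const 2)).to_comp
  have sel : Computable₂ fun n x : ℕ => if n % 2 = 0 then x.unpair.1 else x.unpair.2 :=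
    (Primrec.ite (Primrec.eq.comp (Primrec.nat_mod.comp Primrec.fst (Primrec.const 2))
      (Primrec.const 0)) (Primrec.fst.comp (Primrec.unpair.comp Primrec.snd))
      (Primrec.snd.comp (Primrec.unpair.comp Primrec.snd))).to_comp
  exact (OracleComputableOn.map₂ sel (of_computable Computable.id)
    ((hF.precomp half).pair (hG.precomp half))).congr (by simp [CompTop.join])

/-! ### Computable maps and their realisers -/

/-- The set of all names of points of a represented space. -/
def RepresentedSpace.names (X : RepresentedSpace.{u}) : Set (ℕ → ℕ) :=
  {p | ∃ x, X.IsName p x}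

/-- This replaces partial evaluations by a total functional. A name determines its point, so the
output can be chosen from the name alone. -/
theorem computableMap_iff {X : RepresentedSpace.{u}} {Y : RepresentedSpace.{v}} {f : X → Y} :
    ComputableMap X Y f ↔
      ∃ F, OracleComputableOn X.names F ∧ ∀ p x, X.IsName p x → Y.IsName (F p) (f x) := by
  constructor
  · rintro ⟨c, hc⟩
    choose! F hF hn using hc
    classical
    refine ⟨fun p => if h : ∃ x, X.IsName p x then F p h.choose else p,
      ⟨c, fun p hp n => ?_⟩, fun p x hx => ?_⟩
    · have hp' : ∃ x, X.IsName p x := hp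
      simp only [dif_pos hp']
      exact hF p _ hp'.choose_spec n
    · have hp' : ∃ x, X.IsName p x := ⟨x, hx⟩
      simp only [dif_pos hp']
      rw [X.unique hp'.choose_spec hx]
      exact hn p x hx
  · rintro ⟨F, ⟨c, hc⟩, hF⟩
    exact ⟨c, fun p x hx => ⟨F p, hc p ⟨x, hx⟩, hF p x hx⟩⟩

namespace ComputableMap

theorem congr {X : RepresentedSpace.{u}} {Y : RepresentedSpace.{v}} {f g : X → Y}
    (hf : ComputableMap X Y f) (h : ∀ x, f x = g x) : ComputableMap X Y g :=
  (funext h : f = g) ▸ hf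

theorem comp {X : RepresentedSpace.{u}} {Y : RepresentedSpace.{v}} {Z : RepresentedSpace.{w}}
    {g : Y → Z} {f : X → Y} (hg : ComputableMap Y Z g) (hf : ComputableMap X Y f) :
    ComputableMap X Z fun x => g (f x) := by
  obtain ⟨F, hF, hFn⟩ := computableMap_iff.1 hf
  obtain ⟨G, hG, hGn⟩ := computableMap_iff.1 hg
  exact computableMap_iff.2 ⟨fun p => G (F p), hG.subst' hF fun p ⟨x, hx⟩ => ⟨_, hFn p x hx⟩,
    fun p x hx => hGn _ _ (hFn p x hx)⟩

theorem prodMap {X X' : RepresentedSpace.{u}} {Y Y' : RepresentedSpace.{v}} {f : X → Y}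
    {g : X' → Y'} (hf : ComputableMap X Y f) (hg : ComputableMap X' Y' g) :
    ComputableMap (prod X X') (prod Y Y') fun z => (f z.1, g z.2) := by
  obtain ⟨F, hF, hFn⟩ := computableMap_iff.1 hf
  obtain ⟨G, hG, hGn⟩ := computableMap_iff.1 hg
  refine computableMap_iff.2
    ⟨fun p => join (F fun n => p (2 * n)) (G fun n => p (2 * n + 1)),
      (hF.subst' .even ?_).join (hG.subst' .odd ?_), fun p x hx => ?_⟩
  · rintro p ⟨x, hx⟩
    exact ⟨_, hx.1⟩
  · rintro p ⟨x, hx⟩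
    exact ⟨_, hx.2⟩
  · constructor
    · rw [join_even]
      exact hFn _ _ hx.1
    · rw [join_odd]
      exact hGn _ _ hx.2

end ComputableMap

theorem ComputablyIsomorphic.symm {X : RepresentedSpace.{u}} {Y : RepresentedSpace.{v}}
    (h : ComputablyIsomorphic X Y) : ComputablyIsomorphic Y X := by
  obtain ⟨e, h₁, h₂⟩ := h
  exact ⟨e.symm, h₂, h₁⟩

theorem ComputablyIsomorphic.trans {X : RepresentedSpace.{u}} {Y : RepresentedSpace.{v}}
    {Z : RepresentedSpace.{w}} (h : ComputablyIsomorphic X Y) (h' : ComputablyIsomorphic Y Z) :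
    ComputablyIsomorphic X Z := by
  obtain ⟨e, h₁, h₂⟩ := h
  obtain ⟨e', h₁', h₂'⟩ := h'
  exact ⟨e.trans e', h₁'.comp h₁, h₂.comp h₂'⟩

/-- The preimage of the diagonal under `f × f` is the diagonal when `f` is injective. -/
theorem ComputablyDiscrete.of_injective {X : RepresentedSpace.{u}} {Y : RepresentedSpace.{v}}
    {f : X → Y} (hY : ComputablyDiscrete Y) (hf : ComputableMap X Y f)
    (hinj : Function.Injective f) : ComputablyDiscrete X := by
  have h := ComputableMap.comp hY (hf.prodMap hf)
  exact ComputableMap.congr (X := prod X X) h fun z => propext hinj.eq_iff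

theorem ComputablyHausdorff.of_injective {X : RepresentedSpace.{u}} {Y : RepresentedSpace.{v}}
    {f : X → Y} (hY : ComputablyHausdorff Y) (hf : ComputableMap X Y f)
    (hinj : Function.Injective f) : ComputablyHausdorff X := by
  have h := ComputableMap.comp hY (hf.prodMap hf)
  exact ComputableMap.congr (X := prod X X) h fun z => propext (not_congr hinj.eq_iff)

/-- A realiser of equality in a computably discrete space. -/
theorem ComputablyDiscrete.exists_realiser {X : RepresentedSpace.{u}}
    (h : ComputablyDiscrete X) : ∃ F, OracleComputableOn (prod X X).names F ∧
      ∀ p q x y, X.IsName p x → X.IsName q y → (x = y ↔ ∃ k, F (join p q) k ≠ 0) := by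
  obtain ⟨F, hF, hFn⟩ := computableMap_iff.1 h
  refine ⟨F, hF, fun p q x y hx hy => ?_⟩
  have := hFn (join p q) (x, y) ⟨by rwa [join_even], by rwa [join_odd]⟩
  exact this.trans Function.ne_iff

/-- A realiser of inequality in a computably Hausdorff space. -/
theorem ComputablyHausdorff.exists_realiser {X : RepresentedSpace.{u}}
    (h : ComputablyHausdorff X) : ∃ F, OracleComputableOn (prod X X).names F ∧
      ∀ p q x y, X.IsName p x → X.IsName q y → (x ≠ y ↔ ∃ k, F (join p q) k ≠ 0) := by
  obtain ⟨F, hF, hFn⟩ := computableMap_iff.1 h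
  refine ⟨F, hF, fun p q x y hx hy => ?_⟩
  have := hFn (join p q) (x, y) ⟨by rwa [join_even], by rwa [join_odd]⟩
  exact this.trans Function.ne_iff

theorem join_mem_names {X : RepresentedSpace.{u}} {Y : RepresentedSpace.{v}} {p q : ℕ → ℕ}
    {x : X} {y : Y} (hx : X.IsName p x) (hy : Y.IsName q y) : join p q ∈ (prod X Y).names :=
  ⟨(x, y), by rwa [join_even], by rwa [join_odd]⟩

theorem computablyHausdorff_natSpace : ComputablyHausdorff natSpace := by
  -- In a name of a pair of numbers, the two numbers stand at positions `0` and `1`.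
  refine computableMap_iff.2 ⟨fun p _ => if p 0 = p 1 then 0 else 1, ?_, ?_⟩
  · exact .map₂ (computable₂_ite_eq 0 1) (OracleComputableOn.of_computable (Computable.const 0)).query
      (OracleComputableOn.of_computable (Computable.const 1)).query
  · rintro p ⟨x, y⟩ ⟨rfl, rfl⟩
    change ¬ (p 0 = p 1) ↔ _
    by_cases h : p 0 = p 1 <;> simp [h, funext_iff]

theorem computableMap_natSpace_left {Y : RepresentedSpace.{v}} {f : ℕ → Y} {Q : ℕ → ℕ → ℕ}
    (hQ : Computable₂ Q) (h : ∀ n, Y.IsName (Q n) (f n)) : ComputableMap natSpace Y f := by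
  refine computableMap_iff.2 ⟨fun p => Q (p 0), ?_, ?_⟩
  · exact .map₂ hQ (OracleComputableOn.of_computable (Computable.const 0)).query
      (.of_computable Computable.id)
  · rintro p x rfl
    exact h (p 0)

/-! ### Metric spaces -/

/-- The discrete metric on the natural numbers. -/
def discretePseudometric : ComputablePseudometric where
  d a b := if a = b then 0 else 1
  d_self a := by simp
  d_comm a b := by simp [eq_comm]
  d_triangle a b c := by
    by_cases h : a = b
    · simp [h]
    · by_cases h' : b = c
      · simp [h']
      · simp only [h, h', if_false]
        split_ifs <;> norm_num
  computable := by
    -- The rationals `0` and `1` have the codes `0` and `Nat.pair (Nat.pair 1 0) 0`.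
    refine computableMap_iff.2
      ⟨fun p _ => if p 0 = p 1 then 0 else Nat.pair (Nat.pair 1 0) 0, ?_, ?_⟩
    · exact .map₂ (computable₂_ite_eq 0 _)
        (OracleComputableOn.of_computable (Computable.const 0)).query
        (OracleComputableOn.of_computable (Computable.const 1)).query
    · rintro p ⟨x, y⟩ ⟨rfl, rfl⟩ n
      change dist _ (if p 0 = p 1 then (0 : ℝ) else 1) < _
      by_cases h : p 0 = p 1 <;> simp [h, ratOfNat]

theorem dist_point (P : ComputablePseudometric) (a b : ℕ) :
    dist (P.point a) (P.point b) = P.d a b :=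
  UniformSpace.Completion.dist_eq _ _

theorem discretePseudometric_eq_of_dist_lt {a b : ℕ}
    (h : dist (discretePseudometric.point a) (discretePseudometric.point b) < 1) : a = b := by
  rw [dist_point] at h
  by_contra hab
  simp [discretePseudometric, hab] at h

/-- From index `1` on, the entries of a name are less than `1/2 + 1/2` apart, hence equal, so the
completion adds no points. -/
theorem discretePseudometric_point_bijective : Function.Bijective discretePseudometric.point := by
  refine ⟨fun a b h => discretePseudometric_eq_of_dist_lt (by simp [h]), fun x => ?_⟩
  obtain ⟨p, hp⟩ := discretePseudometric.space.surj x
  replace hp : ∀ n, dist (discretePseudometric.point (p n)) x < (1 / 2) ^ n := hp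
  have heq : ∀ n, p (n + 1) = p 1 := fun n => discretePseudometric_eq_of_dist_lt <| by
    have h₁ := hp (n + 1)
    have h₂ : (1 / 2 : ℝ) ^ (n + 1) ≤ (1 / 2) ^ 1 :=
      pow_le_pow_of_le_one (by norm_num) (by norm_num) (by omega)
    have h₃ := dist_triangle_right (discretePseudometric.point (p (n + 1)))
      (discretePseudometric.point (p 1)) x
    linarith [hp 1]
  refine ⟨p 1, eq_of_dist_lt_two_pow (fun _ => discretePseudometric.point (p 1))
    (fun n => by rw [dist_self]; positivity) fun n => ?_⟩
  cases n with
  | zero => linarith [hp 1]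
  | succ n => exact heq n ▸ hp (n + 1)

theorem isComputableMetricSpace_natSpace : IsComputableMetricSpace natSpace := by
  let e : ℕ ≃ UniformSpace.Completion discretePseudometric.Point :=
    .ofBijective _ discretePseudometric_point_bijective
  refine ⟨discretePseudometric, e, ?_, ?_⟩
  · refine computableMap_natSpace_left (Q := fun n _ => n) Computable.fst fun n k => ?_
    change dist (discretePseudometric.point n) (discretePseudometric.point n) < _
    rw [dist_self]
    positivity
  · refine computableMap_iff.2 ⟨fun p _ => p 1,
      (OracleComputableOn.of_computable (Computable.const 1)).query, fun p x hx => ?_⟩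
    obtain ⟨n, rfl⟩ := e.surjective x
    refine Eq.trans ?_ (e.symm_apply_apply n).symm
    refine discretePseudometric_eq_of_dist_lt ?_
    have : dist (discretePseudometric.point (p 1)) (discretePseudometric.point n) < _ := hx 1
    linarith

theorem computable_two_pow : Computable fun n : ℕ => 2 ^ n := by
  have h : Computable fun n : ℕ => Nat.rec (motive := fun _ => ℕ) 1 (fun _ k => 2 * k) n :=
    Computable.nat_rec Computable.id (Computable.const 1)
      (computable_two_mul.comp (Computable.snd.comp Computable.snd)).to₂
  refine h.of_eq fun n => ?_
  induction n with
  | zero => rfl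
  | succ n ih => rw [pow_succ, ← ih, mul_comm]

/-- The positivity of a real number is recognised from a sufficiently good approximation. -/
def positivityTest (n r : ℕ) : ℕ :=
  if 3 * (r.unpair.2 + 1) + r.unpair.1.unpair.2 * 2 ^ n < r.unpair.1.unpair.1 * 2 ^ n then 1 else 0

theorem computable₂_positivityTest : Computable₂ positivityTest := by
  have h : Primrec₂ fun m r : ℕ =>
      if 3 * (r.unpair.2 + 1) + r.unpair.1.unpair.2 * m < r.unpair.1.unpair.1 * m
        then 1 else 0 := by
    have h₀ : Primrec fun z : ℕ × ℕ => z.2.unpair := Primrec.unpair.comp Primrec.snd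
    have h₁ : Primrec fun z : ℕ × ℕ => z.2.unpair.1.unpair :=
      Primrec.unpair.comp (Primrec.fst.comp h₀)
    refine Primrec.ite (Primrec.nat_lt.comp (Primrec.nat_add.comp
      (Primrec.nat_mul.comp (Primrec.const 3) (Primrec.succ.comp (Primrec.snd.comp h₀)))
      (Primrec.nat_mul.comp (Primrec.snd.comp h₁) Primrec.fst))
      (Primrec.nat_mul.comp (Primrec.fst.comp h₁) Primrec.fst)) (Primrec.const 1) (Primrec.const 0)
  exact h.to_comp.comp (computable_two_pow.comp Computable.fst) Computable.snd

/-- Clearing denominators and moving the subtracted term across turns the comparison into one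
between natural numbers. -/
theorem positivityTest_ne_zero {n r : ℕ} :
    positivityTest n r ≠ 0 ↔ 3 * (1 / 2 : ℝ) ^ n < ratOfNat r := by
  have h2 : (0 : ℝ) < 2 ^ n := by positivity
  have hc : (0 : ℝ) < (r.unpair.2 : ℝ) + 1 := by positivity
  have h : positivityTest n r ≠ 0 ↔
      3 * (r.unpair.2 + 1) + r.unpair.1.unpair.2 * 2 ^ n < r.unpair.1.unpair.1 * 2 ^ n := by
    simp [positivityTest]
  rw [h, ← Nat.cast_lt (α := ℝ), ratOfNat]
  push_cast
  rw [one_div, inv_pow, ← div_eq_mul_inv, div_lt_div_iff₀ h2 hc, sub_mul, lt_sub_iff_add_lt]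

/-- The two approximating points contribute an error below `2⁻ⁿ` each, and so does the computed
distance between them. A value above `3 * 2⁻ⁿ` therefore certifies `x ≠ y`. -/
theorem computablyHausdorff_space (P : ComputablePseudometric) :
    ComputablyHausdorff P.space := by
  obtain ⟨F, hF, hFn⟩ := computableMap_iff.1 P.computable
  -- The alternating sequence is a name of `(a, b)`.
  have hF' : ∀ a b n, dist (ratOfNat (F (fun i => if i % 2 = 0 then a else b) n) : ℝ) (P.d a b)
      < (1 / 2) ^ n := fun a b => hFn _ (a, b) ⟨rfl, rfl⟩
  have sel : Computable₂ fun x i : ℕ => if i % 2 = 0 then x.unpair.1 else x.unpair.2 :=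
    (Primrec.ite (Primrec.eq.comp (Primrec.nat_mod.comp Primrec.snd (Primrec.const 2))
      (Primrec.const 0)) (Primrec.fst.comp (Primrec.unpair.comp Primrec.fst))
      (Primrec.snd.comp (Primrec.unpair.comp Primrec.fst))).to_comp
  have hG : Computable₂ fun x n : ℕ =>
      F (fun i => if i % 2 = 0 then x.unpair.1 else x.unpair.2) n :=
    hF.computable₂ sel fun x => ⟨x.unpair, rfl, rfl⟩
  refine computableMap_iff.2 ⟨fun p n => positivityTest n
    (F (fun i => if i % 2 = 0 then p (2 * n) else p (2 * n + 1)) n), ?_, ?_⟩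
  · refine .map₂ computable₂_positivityTest (.of_computable Computable.id) ?_
    exact (OracleComputableOn.map₂ hG (OracleComputableOn.even.pair .odd)
      (.of_computable Computable.id)).congr (by simp)
  · rintro p ⟨x, y⟩
    change UniformSpace.Completion P.Point at x y
    rintro ⟨hx, hy⟩
    replace hx : ∀ n, dist (P.point (p (2 * n))) x < (1 / 2) ^ n := hx
    replace hy : ∀ n, dist (P.point (p (2 * n + 1))) y < (1 / 2) ^ n := hy
    have key : ∀ n, |ratOfNat (F (fun i => if i % 2 = 0 then p (2 * n) else p (2 * n + 1)) n)
        - dist x y| < 3 * (1 / 2 : ℝ) ^ n := fun n => by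
      have h₁ := hF' (p (2 * n)) (p (2 * n + 1)) n
      have h₂ := dist_dist_dist_le (P.point (p (2 * n))) (P.point (p (2 * n + 1))) x y
      rw [dist_point] at h₂
      have h₃ := dist_triangle (ratOfNat (F (fun i => if i % 2 = 0 then p (2 * n) else
        p (2 * n + 1)) n) : ℝ) (P.d (p (2 * n)) (p (2 * n + 1))) (dist x y)
      rw [← Real.dist_eq]
      linarith [hx n, hy n]
    change ¬ (x = y) ↔ _
    rw [Function.ne_iff]
    simp only [positivityTest_ne_zero]
    constructor
    · intro hxy
      have hd : 0 < dist x y := dist_pos.2 hxy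
      -- If `dist x y` exceeds `6 * 2⁻ⁿ`, more than `3 * 2⁻ⁿ` remains after the error.
      obtain ⟨n, hn⟩ := exists_pow_lt_of_lt_one (by positivity : 0 < dist x y / 6)
        (by norm_num : (1 / 2 : ℝ) < 1)
      exact ⟨n, by linarith [abs_lt.1 (key n)]⟩
    · rintro ⟨n, hn⟩ rfl
      have := (abs_lt.1 (key n)).2
      rw [dist_self] at this
      linarith

/-! ### Unbounded search and removal of repetitions -/

theorem computable_decide_eq {α : Type*} [Primcodable α] {f g : α → ℕ} (hf : Computable f)
    (hg : Computable g) : Computable fun a => decide (f a = g a) :=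
  (PrimrecRel.decide Primrec.eq).to_comp.comp hf hg

theorem exists_computable_find {α : Type*} [Primcodable α] {w : α → ℕ → ℕ}
    (hw : Computable₂ w) (h : ∀ a, ∃ k, w a k ≠ 0) :
    ∃ f : α → ℕ, Computable f ∧ ∀ a, w a (f a) ≠ 0 ∧ ∀ m < f a, w a m = 0 := by
  refine ⟨fun a => Nat.find (h a), ?_, fun a => ⟨Nat.find_spec (h a),
    fun m hm => not_not.1 (Nat.find_min (h a) hm)⟩⟩
  have hd : Computable₂ fun a k => decide (w a k ≠ 0) :=
    (Primrec.not.to_comp.comp (computable_decide_eq hw (Computable.const 0))).of_eq (by simp)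
  refine (Partrec.rfind (p := fun a k => Part.some (decide (w a k ≠ 0))) hd.partrec₂).of_eq
    fun a => Part.eq_some_iff.2 (Nat.mem_rfind.2 ?_)
  refine ⟨by simpa using Nat.find_spec (h a), fun {m} hm => ?_⟩
  have := not_not.1 (Nat.find_min (h a) hm)
  simp [this]

theorem computable₂_iterate {f : ℕ → ℕ} (hf : Computable f) :
    Computable₂ fun a n => f^[n] a := by
  have h : Computable fun z : ℕ × ℕ =>
      Nat.rec (motive := fun _ => ℕ) z.1 (fun _ k => f k) z.2 :=
    Computable.nat_rec Computable.snd Computable.fst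
      (hf.comp (Computable.snd.comp Computable.snd)).to₂
  refine h.of_eq fun ⟨a, n⟩ => ?_
  induction n with
  | zero => rfl
  | succ n ih => exact (congrArg f ih).trans (Function.iterate_succ_apply' f n a).symm

theorem computable₂_join {P Q : ℕ → ℕ → ℕ} (hP : Computable₂ P) (hQ : Computable₂ Q) :
    Computable₂ fun x i => join (P x) (Q x) i := by
  have half : Computable fun z : ℕ × ℕ => z.2 / 2 :=
    (Primrec.nat_div.comp Primrec.snd (Primrec.const 2)).to_comp
  have even : Computable fun z : ℕ × ℕ => decide (z.2 % 2 = 0) :=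
    computable_decide_eq (Primrec.nat_mod.comp Primrec.snd (Primrec.const 2)).to_comp
      (Computable.const 0)
  exact (Computable.cond even (hP.comp Computable.fst half)
    (hQ.comp Computable.fst half)).of_eq fun z => by simp [join, Bool.cond_decide]

/-- A decidable equivalence relation with infinitely many classes has a computable
transversal. -/
theorem exists_computable_transversal {X : Type*} [Infinite X] {x : ℕ → X}
    (hx : Function.Surjective x) {δ : ℕ → ℕ → ℕ} (hδ : Computable₂ δ)
    (h : ∀ i j, δ i j ≠ 0 ↔ x i = x j) :
    ∃ s : ℕ → ℕ, Computable s ∧ Function.Bijective fun k => x (s k) := by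
  -- `first i` is the least index of the point `x i`, a canonical representative of its class.
  obtain ⟨first, hfirst, hf⟩ := exists_computable_find hδ fun i => ⟨i, (h i i).2 rfl⟩
  have hxf : ∀ i, x (first i) = x i := fun i => ((h _ _).1 (hf i).1).symm
  have hle : ∀ i j, x i = x j → first i ≤ j := fun i j hij => by
    by_contra hlt
    exact (h i j).2 hij ((hf i).2 j (not_le.1 hlt))
  have hcongr : ∀ i j, x i = x j → first i = first j := fun i j hij =>
    le_antisymm (hle _ _ (hij.trans (hxf j).symm)) (hle _ _ (hij.symm.trans (hxf i).symm))
  have hidem : ∀ i, first (first i) = first i := fun i => hcongr _ _ (hxf i)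
  -- If no representative exceeded `i`, the indices up to `i` would name every point of `X`.
  have hinf : ∀ i, ∃ j, i < j ∧ first j = j := by
    intro i
    by_contra! hi
    have : Set.univ ⊆ x '' Set.Iic i := fun y _ => by
      obtain ⟨j, rfl⟩ := hx y
      exact ⟨first j, not_lt.1 fun hj => hi _ hj (hidem j), hxf j⟩
    exact Set.infinite_univ (((Set.finite_Iic i).image x).subset this)
  have htest : Computable₂ fun i j : ℕ => if i < j ∧ first j = j then 1 else 0 := by
    have h₁ : Computable fun z : ℕ × ℕ => decide (z.1 < z.2) :=
      (PrimrecRel.decide Primrec.nat_lt).to_comp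
    have h₂ : Computable fun z : ℕ × ℕ => decide (first z.2 = z.2) :=
      computable_decide_eq (hfirst.comp Computable.snd) Computable.snd
    exact (Computable.cond (Primrec.and.to_comp.comp h₁ h₂) (Computable.const 1)
      (Computable.const 0)).of_eq fun z => by simp [Bool.cond_eq_ite]
  obtain ⟨next, hnext, hn⟩ := exists_computable_find htest fun i => by simpa using hinf i
  have hn₁ : ∀ i, i < next i ∧ first (next i) = next i := fun i => by simpa using (hn i).1
  have hn₂ : ∀ i, ∀ j < next i, i < j → first j ≠ j := fun i j hj => by simpa using (hn i).2 j hj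
  have hs : ∀ k, first (next^[k] 0) = next^[k] 0 := by
    intro k
    cases k with
    | zero => exact Nat.le_zero.1 (hle 0 0 rfl)
    | succ k =>
      rw [Function.iterate_succ_apply']
      exact (hn₁ _).2
  have hmono : StrictMono fun k => next^[k] 0 := strictMono_nat_of_lt_succ fun k => by
    rw [Function.iterate_succ_apply']
    exact (hn₁ _).1
  -- The iterates of `next` from `0` bracket every number, so no representative is skipped.
  have hbetween : ∀ n, ∃ k, next^[k] 0 ≤ n ∧ n < next^[k + 1] 0 := by
    intro n
    induction n with
    | zero => exact ⟨0, le_rfl, (hn₁ 0).1⟩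
    | succ n ih =>
      obtain ⟨k, h₁, h₂⟩ := ih
      by_cases hk : n + 1 < next^[k + 1] 0
      · exact ⟨k, by omega, hk⟩
      · exact ⟨k + 1, by omega, lt_of_le_of_lt h₂ (hmono (Nat.lt_succ_self (k + 1)))⟩
  refine ⟨fun k => next^[k] 0, (computable₂_iterate hnext).comp (Computable.const 0)
    Computable.id, fun k l hkl => ?_, fun y => ?_⟩
  · have := hcongr _ _ hkl
    rw [hs, hs] at this
    exact hmono.injective this
  · obtain ⟨i, rfl⟩ := hx y
    obtain ⟨k, h₁, h₂⟩ := hbetween (first i)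
    rw [Function.iterate_succ_apply'] at h₂
    rcases h₁.lt_or_eq with h₁ | h₁
    · exact absurd (hidem i) (hn₂ _ _ h₂ h₁)
    · exact ⟨k, (congrArg x h₁).trans (hxf i)⟩

/-- An infinite computably discrete and computably Hausdorff space whose points are enumerated
by a computable sequence is computably isomorphic to the natural numbers. -/
theorem computablyIsomorphic_natSpace {X : RepresentedSpace.{u}} [Infinite X]
    (hdisc : ComputablyDiscrete X) (hhaus : ComputablyHausdorff X) {Q : ℕ → ℕ → ℕ}
    (hQ : Computable₂ Q) {x : ℕ → X} (hx : Function.Surjective x)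
    (hQx : ∀ n, X.IsName (Q n) (x n)) : ComputablyIsomorphic X natSpace := by
  obtain ⟨F, hF, hFn⟩ := hdisc.exists_realiser
  obtain ⟨G, hG, hGn⟩ := hhaus.exists_realiser
  have hfst : Computable fun z : ℕ × ℕ => z.1.unpair.1 :=
    Computable.fst.comp (Computable.unpair.comp Computable.fst)
  have hsnd : Computable fun z : ℕ × ℕ => z.1.unpair.2 :=
    Computable.snd.comp (Computable.unpair.comp Computable.fst)
  have hJ : Computable₂ fun m i : ℕ => join (Q m.unpair.1) (Q m.unpair.2) i :=
    computable₂_join (hQ.comp hfst Computable.snd) (hQ.comp hsnd Computable.snd)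
  have hJn : ∀ m : ℕ, join (Q m.unpair.1) (Q m.unpair.2) ∈ (prod X X).names :=
    fun m => join_mem_names (hQx _) (hQx _)
  have hFJ := hF.computable₂ hJ hJn
  have hGJ := hG.computable₂ hJ hJn
  -- Discreteness recognises equality and Hausdorffness recognises inequality, so one of the two
  -- must accept.
  have hex : ∀ m : ℕ, ∃ k, F (join (Q m.unpair.1) (Q m.unpair.2)) k +
      G (join (Q m.unpair.1) (Q m.unpair.2)) k ≠ 0 := fun m => by
    by_cases hm : x m.unpair.1 = x m.unpair.2
    · obtain ⟨k, hk⟩ := (hFn _ _ _ _ (hQx _) (hQx _)).1 hm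
      exact ⟨k, by omega⟩
    · obtain ⟨k, hk⟩ := (hGn _ _ _ _ (hQx _) (hQx _)).1 hm
      exact ⟨k, by omega⟩
  obtain ⟨t, ht, htn⟩ := exists_computable_find
    (w := fun m k : ℕ => F (join (Q m.unpair.1) (Q m.unpair.2)) k +
      G (join (Q m.unpair.1) (Q m.unpair.2)) k) (Primrec.nat_add.to_comp.comp hFJ hGJ) hex
  -- At the stopping stage, a nonzero value of `F` proves equality; if it is zero, `G` has accepted
  -- and the points differ.
  have hδ : Computable₂ fun i j => F (join (Q i) (Q j)) (t (Nat.pair i j)) :=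
    ((hFJ.comp Computable.id ht).comp Primrec₂.natPair.to_comp).of_eq (by simp)
  obtain ⟨s, hs, hbij⟩ := exists_computable_transversal hx hδ fun i j => by
    refine ⟨fun h => (hFn _ _ _ _ (hQx i) (hQx j)).2 ⟨_, h⟩, fun h h₀ => ?_⟩
    have := (htn (Nat.pair i j)).1
    simp only [Nat.unpair_pair, h₀, zero_add] at this
    exact (hGn _ _ _ _ (hQx i) (hQx j)).2 ⟨_, this⟩ h
  have hsQ : Computable₂ fun k i => Q (s k) i :=
    hQ.comp (hs.comp Computable.fst) Computable.snd
  refine ComputablyIsomorphic.symm ⟨(Equiv.ofBijective _ hbij : ℕ ≃ X),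
    computableMap_natSpace_left hsQ fun n => hQx (s n), ?_⟩
  have hH : OracleComputableOn X.names fun p m =>
      join p (Q (s m.unpair.1)) m.unpair.2 := by
    -- Only one entry of `p` is needed, so a constant sequence carrying that entry stands in for
    -- `p`.
    have h₁ : Computable₂ fun m i : ℕ => join (fun _ => m.unpair.2) (Q (s m.unpair.1)) i :=
      computable₂_join hsnd (hsQ.comp hfst Computable.snd)
    have h₂ : Computable fun m : ℕ => m.unpair.2 := Computable.snd.comp Computable.unpair
    have h₃ : Computable fun m : ℕ => m.unpair.2 / 2 :=
      Primrec.nat_div.to_comp.comp h₂ (Computable.const 2)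
    exact (OracleComputableOn.map₂ h₁ ((OracleComputableOn.of_computable
      (Computable.fst.comp Computable.unpair)).pair (OracleComputableOn.oracle.precomp h₃))
      (OracleComputableOn.of_computable h₂)).congr (by simp [join])
  have hK : OracleComputableOn X.names fun p m =>
      F (join p (Q (s m.unpair.1))) m.unpair.2 :=
    (hF.subst hH fun p ⟨y, hy⟩ n => by simpa using join_mem_names hy (hQx (s n))).congr (by simp)
  have hzero : Computable fun n : ℕ => if n = 0 then 1 else 0 :=
    (computable₂_ite_eq 1 0).comp Computable.id (Computable.const 0)
  -- The search is over pairs of an index and a stage at which equality with the indexed point is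
  -- recognised; `hzero` is there because `find` looks for zeros.
  obtain ⟨T, hT, hTn⟩ := ((hK.precomp (Computable.snd.comp Computable.unpair)).map hzero).find
    (fun p ⟨y, hy⟩ n => by
      obtain ⟨k, rfl⟩ := hbij.surjective y
      obtain ⟨j, hj⟩ := (hFn _ _ _ _ hy (hQx (s k))).1 rfl
      exact ⟨Nat.pair k j, by simpa using hj⟩)
  refine computableMap_iff.2 ⟨fun p n => (T p n).unpair.1,
    hT.map (Computable.fst.comp Computable.unpair), fun p y hy => ?_⟩
  have := hTn p ⟨y, hy⟩ 0
  simp only [Nat.unpair_pair, ite_eq_right_iff, one_ne_zero, imp_false] at this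
  exact ((Equiv.symm_apply_eq (Equiv.ofBijective _ hbij : ℕ ≃ X)).2
    ((hFn _ _ _ _ hy (hQx _)).2 ⟨_, this⟩)).symm

/-! ### Ideals -/

/-- The stage `k` bounds the evaluation; the encoding of an `Option` is zero exactly for `none`. -/
theorem exists_witness_of_rePred {α : Type*} [Primcodable α] {p : α → Prop} (hp : REPred p) :
    ∃ w : α → ℕ → ℕ, Computable₂ w ∧ ∀ a, p a ↔ ∃ k, w a k ≠ 0 := by
  obtain ⟨c, hc⟩ := Nat.Partrec.Code.exists_code.1 hp
  refine ⟨fun a k => (Encodable.encode (c.evaln k (Encodable.encode a))), ?_, fun a => ?_⟩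
  · exact Computable.encode.comp (Nat.Partrec.Code.primrec_evaln.to_comp.comp
      ((Computable.snd.pair (Computable.const c)).pair (Computable.encode.comp Computable.fst)))
  · have h₁ : p a ↔ (c.eval (Encodable.encode a)).Dom := by
      simp [hc, Part.dom_iff_mem, Part.mem_assert_iff]
    rw [h₁, Part.dom_iff_mem]
    simp only [Nat.Partrec.Code.evaln_complete]
    rw [exists_comm]
    refine exists_congr fun k => ?_
    cases c.evaln k (Encodable.encode a) <;> simp

/-- All pairs of a candidate and a stage are run through, with the known element `a` as output
whenever the test fails. -/
theorem exists_computable_range {W : ℕ → ℕ → ℕ} (hW : Computable₂ W) {a : ℕ}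
    (ha : ∃ k, W a k ≠ 0) :
    ∃ f : ℕ → ℕ, Computable f ∧ ∀ n, (∃ i, f i = n) ↔ ∃ k, W n k ≠ 0 := by
  have hW' : Computable fun i : ℕ => W i.unpair.1 i.unpair.2 :=
    hW.comp (Computable.fst.comp Computable.unpair) (Computable.snd.comp Computable.unpair)
  refine ⟨fun i => if W i.unpair.1 i.unpair.2 = 0 then a else i.unpair.1, ?_, fun n => ⟨?_, ?_⟩⟩
  · exact (Computable.nat_casesOn hW' (Computable.const a)
      ((Computable.fst.comp Computable.unpair).comp Computable.fst).to₂).of_eq fun i => by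
        dsimp only
        cases W i.unpair.1 i.unpair.2 <;> rfl
  · rintro ⟨i, rfl⟩
    dsimp only
    split_ifs with h
    · exact ha
    · exact ⟨_, h⟩
  · rintro ⟨k, hk⟩
    exact ⟨Nat.pair n k, by simp [hk]⟩

/-- In a computably discrete space of ideals, every ideal has an element which lies in no other
ideal. -/
theorem exists_isolating {r : ℕ → ℕ → Prop} (htrans : ∀ a b c, r a b → r b c → r a c)
    (hdisc : ComputablyDiscrete (idealSpace r)) (I : idealSpace r) :
    ∃ z ∈ I.1, ∀ J : idealSpace r, z ∈ J.1 → J = I := by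
  obtain ⟨F, hF, hFn⟩ := hdisc.exists_realiser
  obtain ⟨p, hp⟩ := (idealSpace r).surj I
  obtain ⟨k, hk⟩ := (hFn p p I I hp hp).1 rfl
  obtain ⟨N, hN⟩ := hF.exists_use (join_mem_names hp hp) k
  have hpI : ∀ i, p i ∈ I.1 := fun i => by
    rw [show I.1 = Set.range p from hp]
    exact ⟨i, rfl⟩
  -- Directedness, applied repeatedly, bounds any finite part of the name inside `I`.
  have hbound : ∀ n, ∃ z ∈ I.1, ∀ i < n, r (p i) z := by
    intro n
    induction n with
    | zero =>
      obtain ⟨z, hz⟩ := I.2.nonempty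
      exact ⟨z, hz, by simp⟩
    | succ n ih =>
      obtain ⟨z, hz, hzn⟩ := ih
      obtain ⟨y, hy, h₁, h₂⟩ := I.2.directed _ hz _ (hpI n)
      refine ⟨y, hy, fun i hi => ?_⟩
      rcases Nat.lt_succ_iff_lt_or_eq.1 hi with hi | rfl
      · exact htrans _ _ _ (hzn i hi) h₁
      · exact h₂
  obtain ⟨z, hz, hzN⟩ := hbound N
  refine ⟨z, hz, fun J hJ => ?_⟩
  obtain ⟨q, hq⟩ := (idealSpace r).surj J
  -- A name of `J` may begin with the first `N` entries of `p`: these lie below `z`, hence in `J`.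
  have hq' : (idealSpace r).IsName (fun i => if i < N then p i else q (i - N)) J := by
    have hqJ : J.1 = Set.range q := hq
    refine Set.Subset.antisymm ?_ ?_
    · rw [hqJ]
      rintro _ ⟨i, rfl⟩
      exact ⟨i + N, by simp⟩
    · rintro _ ⟨i, rfl⟩
      dsimp only
      split_ifs with hi
      · exact J.2.down _ ⟨z, hJ, hzN i hi⟩
      · rw [hqJ]
        exact ⟨_, rfl⟩
  refine ((hFn p _ I J hp hq').2 ⟨k, ?_⟩).symm
  rwa [hN _ (join_mem_names hp hq') fun i hi => ?_]
  have : i / 2 < N := by omega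
  simp [join, this]

/-- In a computably overt space, it is semidecidable uniformly in `n` whether some point is mapped
to an ideal that contains `n`. -/
theorem ComputablyOvert.exists_witness {X : RepresentedSpace.{u}} (h : ComputablyOvert X)
    {r : ℕ → ℕ → Prop} {f : X → idealSpace r} (hf : ComputableMap X (idealSpace r) f) :
    ∃ W : ℕ → ℕ → ℕ, Computable₂ W ∧ ∀ n, (∃ x, n ∈ (f x).1) ↔ ∃ k, W n k ≠ 0 := by
  obtain ⟨F, hF, hFn⟩ := computableMap_iff.1 h
  obtain ⟨G, hG, hGn⟩ := computableMap_iff.1 hf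
  have hmem : ∀ q x, X.IsName q x → ∀ n, n ∈ (f x).1 ↔ ∃ k, G q k = n := fun q x hx n => by
    rw [show (f x).1 = Set.range (G q) from hGn q x hx]
    exact Iff.rfl
  -- The number `n` is read from the oracle part of the code, at position `1` of the joined oracle,
  -- so one program `c` serves all `n`.
  obtain ⟨c, hc⟩ : OracleComputableOn {p | (fun n => p (2 * n)) ∈ X.names} fun p k =>
      if G (fun n => p (2 * n)) k = p 1 then 1 else 0 :=
    .map₂ (computable₂_ite_eq 1 0) (hG.subst' OracleComputableOn.even fun _ hp => hp)
      (OracleComputableOn.of_computable (Computable.const 1)).query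
  have hcodes : ∀ n, CodesRealiser X sierpinski (fun k => if k = 0 then c.toNat else n)
      fun x => n ∈ (f x).1 := by
    intro n q x hx
    refine ⟨fun k => if G q k = n then 1 else 0, fun k => ?_, ?_⟩
    · simp only [if_true, OracleCode.ofNat_toNat, Nat.add_eq_zero_iff, one_ne_zero, and_false,
        if_false]
      have := hc (join q fun _ => n) (by
        change (fun m => join q (fun _ => n) (2 * m)) ∈ X.names
        rw [join_even]
        exact ⟨x, hx⟩) k
      dsimp only at this
      rw [join_even] at this
      simpa [join] using this
    · change n ∈ (f x).1 ↔ _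
      rw [hmem q x hx, Function.ne_iff]
      simp
  have hP : Computable₂ fun n k : ℕ => if k = 0 then c.toNat else n :=
    (Primrec.ite (Primrec.eq.comp Primrec.snd (Primrec.const 0)) (Primrec.const _)
      Primrec.fst).to_comp
  let U : ℕ → opens X := fun n => ⟨fun x => n ∈ (f x).1, _, hcodes n⟩
  exact ⟨_, hF.computable₂ hP fun n => ⟨U n, hcodes n⟩,
    fun n => (hFn (fun k => if k = 0 then c.toNat else n) (U n) (hcodes n)).trans Function.ne_iff⟩

/-- The ideal generated by an ascending chain. -/
theorem isIdeal_of_chain {r : ℕ → ℕ → Prop} (htrans : ∀ a b c, r a b → r b c → r a c)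
    {c : ℕ → ℕ} (hc : ∀ k, r (c k) (c (k + 1))) : IsIdeal r {m | ∃ k, r m (c k)} := by
  have hlt : ∀ k l, k < l → r (c k) (c l) := fun k l hkl =>
    Nat.le_induction (hc k) (fun n _ ih => htrans _ _ _ ih (hc n)) l hkl
  refine ⟨⟨c 0, 1, hc 0⟩, ?_, ?_⟩
  · rintro m ⟨n, ⟨k, hk⟩, hmn⟩
    exact ⟨k, htrans _ _ _ hmn hk⟩
  · rintro m ⟨k, hk⟩ n ⟨l, hl⟩
    -- As `r` need not be reflexive, the upper bound is taken one step further along the chain, and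
    -- the next step puts it into the ideal.
    exact ⟨c (max k l + 1), ⟨max k l + 2, hc _⟩,
      htrans _ _ _ hk (hlt _ _ (by omega)), htrans _ _ _ hl (hlt _ _ (by omega))⟩

/-- A non-empty computably discrete, computably Quasi-Polish space is enumerated by a computable
sequence. -/
theorem ComputablyQuasiPolish.exists_computable_enumeration {X : RepresentedSpace.{u}}
    [Nonempty X] (hqp : ComputablyQuasiPolish X) (hdisc : ComputablyDiscrete X) :
    ∃ Q : ℕ → ℕ → ℕ, Computable₂ Q ∧
      ∃ x : ℕ → X, Function.Surjective x ∧ ∀ n, X.IsName (Q n) (x n) := by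
  obtain ⟨⟨r, htrans, hre, e, he, hes⟩, hovert⟩ := hqp
  have hdisc' : ComputablyDiscrete (idealSpace r) := hdisc.of_injective hes e.symm.injective
  obtain ⟨W, hW, hWn⟩ := hovert.exists_witness he
  obtain ⟨w, hw, hwn⟩ := exists_witness_of_rePred hre
  obtain ⟨x₀⟩ := ‹Nonempty X›
  obtain ⟨a, ha⟩ := (e x₀).2.nonempty
  obtain ⟨f, hf, hfn⟩ := exists_computable_range hW ((hWn a).1 ⟨x₀, ha⟩)
  have hfI : ∀ n, (∃ i, f i = n) ↔ ∃ I : idealSpace r, n ∈ I.1 := fun n =>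
    (hfn n).trans ((hWn n).symm.trans ⟨fun ⟨x, hx⟩ => ⟨_, hx⟩,
      fun ⟨I, hI⟩ => ⟨e.symm I, by rwa [e.apply_symm_apply]⟩⟩)
  have hstep : Computable₂ fun i m : ℕ => w (f i, f m.unpair.1) m.unpair.2 :=
    hw.comp ((hf.comp Computable.fst).pair
      (hf.comp (Computable.fst.comp (Computable.unpair.comp Computable.snd))))
      (Computable.snd.comp (Computable.unpair.comp Computable.snd))
  -- Directedness applied to `f i` twice gives an element above it in the same ideal. The search may
  -- find one from another ideal, which is harmless.
  obtain ⟨T, hT, hTn⟩ := exists_computable_find hstep fun i => by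
    obtain ⟨I, hI⟩ := (hfI (f i)).1 ⟨i, rfl⟩
    obtain ⟨z, hz, hr, -⟩ := I.2.directed _ hI _ hI
    obtain ⟨j, rfl⟩ := (hfI z).2 ⟨I, hz⟩
    obtain ⟨k, hk⟩ := (hwn (f i, f j)).1 hr
    exact ⟨Nat.pair j k, by simpa using hk⟩
  have hτ : Computable fun i => (T i).unpair.1 :=
    Computable.fst.comp (Computable.unpair.comp hT)
  set τ : ℕ → ℕ := fun i => (T i).unpair.1
  have hchain : ∀ i k, r (f (τ^[k] i)) (f (τ^[k + 1] i)) := fun i k => by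
    rw [Function.iterate_succ_apply']
    exact (hwn (_, _)).2 ⟨_, (hTn _).1⟩
  have hc : Computable₂ fun i k => f (τ^[k] i) := hf.comp (computable₂_iterate hτ)
  let I : ℕ → idealSpace r := fun i => ⟨_, isIdeal_of_chain htrans (hchain i)⟩
  -- This enumerates the ideal generated by the chain, with its member `f i` as default.
  let P : ℕ → ℕ → ℕ := fun i t =>
    if w (t.unpair.1, f (τ^[t.unpair.2.unpair.1] i)) t.unpair.2.unpair.2 = 0 then f i
      else t.unpair.1
  have hP : Computable₂ P := by
    have h₁ : Computable fun z : ℕ × ℕ => z.2.unpair := Computable.unpair.comp Computable.snd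
    have h₂ : Computable fun z : ℕ × ℕ => z.2.unpair.2.unpair :=
      Computable.unpair.comp (Computable.snd.comp h₁)
    have h₃ : Computable fun z : ℕ × ℕ => w (z.2.unpair.1, f (τ^[z.2.unpair.2.unpair.1] z.1))
        z.2.unpair.2.unpair.2 :=
      hw.comp ((Computable.fst.comp h₁).pair
        (hc.comp Computable.fst (Computable.fst.comp h₂))) (Computable.snd.comp h₂)
    exact (Computable.nat_casesOn h₃ (hf.comp Computable.fst)
      ((Computable.fst.comp h₁).comp Computable.fst).to₂).of_eq fun z => by
        dsimp only [P]
        cases w (z.2.unpair.1, f (τ^[z.2.unpair.2.unpair.1] z.1)) z.2.unpair.2.unpair.2 <;> rfl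
  have hfmem : ∀ i, f i ∈ (I i).1 := fun i => ⟨1, hchain i 0⟩
  have hPn : ∀ i, (idealSpace r).IsName (P i) (I i) := by
    intro i
    refine Set.Subset.antisymm ?_ ?_
    · rintro m ⟨k, hk⟩
      obtain ⟨l, hl⟩ := (hwn (_, _)).1 hk
      exact ⟨Nat.pair m (Nat.pair k l), by simp [P, hl]⟩
    · rintro _ ⟨t, rfl⟩
      dsimp only [P]
      split_ifs with h
      · exact hfmem i
      · exact ⟨_, (hwn (_, _)).2 ⟨_, h⟩⟩
  -- Whatever route the chain takes, its ideal contains its starting point; if that isolates `J`,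
  -- the ideal is `J`.
  have hI : Function.Surjective I := fun J => by
    obtain ⟨z, hz, hJ⟩ := exists_isolating htrans hdisc' J
    obtain ⟨i, rfl⟩ := (hfI z).2 ⟨J, hz⟩
    exact ⟨i, hJ _ (hfmem i)⟩
  obtain ⟨S, hS, hSn⟩ := computableMap_iff.1 hes
  exact ⟨fun n => S (P n), hS.computable₂ hP fun n => ⟨_, hPn n⟩, fun n => e.symm (I n),
    e.symm.surjective.comp hI, fun n => hSn _ _ (hPn n)⟩

end CompTop

theorem proposition16 (X : CompTop.RepresentedSpace.{u}) (hinf : Infinite X.carrier)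
    (hdisc : CompTop.ComputablyDiscrete X) (hqp : CompTop.ComputablyQuasiPolish X) :
    List.TFAE
      [CompTop.ComputablyIsomorphic X CompTop.natSpace,
        ∃ ι : X.carrier → CompTop.natSpace.carrier,
          CompTop.ComputableMap X CompTop.natSpace ι ∧ Function.Injective ι,
        CompTop.IsComputableMetricSpace X,
        CompTop.ComputablyHausdorff X] := by
  tfae_have 1 → 2 := fun ⟨e, he, _⟩ => ⟨e, he, e.injective⟩
  tfae_have 2 → 4 := fun ⟨_, hι, hinj⟩ =>
    CompTop.computablyHausdorff_natSpace.of_injective hι hinj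
  tfae_have 1 → 3 := fun h => by
    obtain ⟨P, hP⟩ := CompTop.isComputableMetricSpace_natSpace
    exact ⟨P, h.trans hP⟩
  tfae_have 3 → 4 := fun ⟨P, e, he, _⟩ =>
    (CompTop.computablyHausdorff_space P).of_injective he e.injective
  tfae_have 4 → 1 := fun h => by
    obtain ⟨Q, hQ, x, hx, hQx⟩ := hqp.exists_computable_enumeration hdisc
    exact CompTop.computablyIsomorphic_natSpace hdisc h hQ hx hQx
  tfae_finish
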